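/- For $n \ge 3$ let $C_n$ be the cycle on $n$ vertices, with Laplacian matrix $L = \Delta - A$ (degree matrix minus adjacency matrix), and let $U(t) = \exp(itL)$. Let $\{a,b\}$ and $\{c,d\}$ be two different pairs of distinct vertices. We say that there is perfect Laplacian pair state transfer between $(a,b)$ and $(c,d)$ at time $t \ge 0$ if $U(t)(e_a - e_b) = \gamma (e_c - e_d)$ for some $\gamma \in \mathbb{C}$ with $|\gamma| = 1$, where $e_v$ denotes the characteristic vector of the vertex $v$. Theorem. Let $n \ge 3$. There are two different pairs $\{a,b\} \neq \{c,d\}$ of distinct vertices of $C_n$, at least one of which is an edge, such that perfect Laplacian pair state transfer occurs between $(a,b)$ and $(c,d)$ at some time $t \ge 0$, if and only if $n = 4$. Moreover, for any two opposite (that is, vertex-disjoint) edges $\{a,b\}$ and $\{c,d\}$ of $C_4$, perfect Laplacian pair state transfer occurs between $(a,b)$ and $(c,d)$ at time $\frac{\pi}{2}$. -/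

import Mathlib

noncomputable section

namespace PairStateTransfer

variable {V : Type*} [Fintype V] [DecidableEq V]

/-- The transition matrix `U(t) = exp(i t L)` of the continuous quantum walk on `G` whose
Hamiltonian is the Laplacian matrix `L = Δ - A`. -/
def transitionMatrix (G : SimpleGraph V) [DecidableRel G.Adj] (t : ℝ) : Matrix V V ℂ :=
  NormedSpace.exp ((Complex.I * (t : ℂ)) • G.lapMatrix ℂ)

/-- The (unnormalized) pair state `e_a - e_b`. -/
def pairState (a b : V) : V → ℂ :=
  Pi.single a 1 - Pi.single b 1

/-- Perfect Laplacian pair state transfer at time `t` between the pairs `{a, b}` and `{c, d}`: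
these are two different pairs of distinct vertices, `t ≥ 0`, and
`U(t) (e_a - e_b) = γ (e_c - e_d)` for some complex `γ` with `|γ| = 1`.
(Transfer of a pair to itself is periodicity, not state transfer.) -/
def HasPairPSTAt (G : SimpleGraph V) [DecidableRel G.Adj] (a b c d : V) (t : ℝ) : Prop :=
  a ≠ b ∧ c ≠ d ∧ s(a, b) ≠ s(c, d) ∧ 0 ≤ t ∧
    ∃ γ : ℂ, ‖γ‖ = 1 ∧
      (transitionMatrix G t).mulVec (pairState a b) = γ • pairState c d

/-- Perfect Laplacian pair state transfer between `{a, b}` and `{c, d}` at some time. -/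
def HasPairPST (G : SimpleGraph V) [DecidableRel G.Adj] (a b c d : V) : Prop :=
  ∃ t : ℝ, HasPairPSTAt G a b c d t

end PairStateTransfer

end

/-!
The characters `j ↦ ζ ^ j` with `ζ ^ n = 1` are eigenvectors of the Laplacian of `C_n`, with
eigenvalue `θ_ζ = 2 - ζ - ζ⁻¹`. Pairing `U(t) (e_a - e_b) = γ (e_c - e_d)` with them gives
`exp (i t θ_ζ) (ζ ^ a - ζ ^ b) = γ (ζ ^ c - ζ ^ d)` for every `n`-th root of unity `ζ`
(`exp_mul_sub_eq_of_transfer`, `lapMatrix_cycleGraph_mulVec_pow`).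

Let one of the pairs be an edge; by time reversal it is `{a, b}`. Norms at a primitive root `ω`
show that `{c, d}` is an edge too (`eq_add_one_of_character_transfer`), so after reorienting it the
equation becomes `exp (i t θ_ζ) = γ ζ ^ k` for `ζ ≠ 1`, where `k = c - a ≠ 0`. Since
`θ_ζ = θ_{ζ⁻¹}`, this forces `n = 2 k`, and `θ_ω + θ_{-ω} = 4 = θ_{-1}` forces `γ = 1`
(`eq_four_of_translation`). Hence `exp (i t θ_ζ) = ζ ^ (n / 2)` for all `ζ`, and this excludes all
`n` but `4`:
* if `p > 1` is an odd divisor of `n`, then `∑ θ_ζ` over a coset of the group of `p`-th roots of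
  unity is `2 p` for every coset, whereas the product of the right sides is `1` on one coset and
  `-1` on another (`not_odd_dvd_of_exp_eq_pow`);
* if `8 ∣ n`, the eigenvalues `2` and `2 - √2` contradict the irrationality of `√2`
  (`not_eight_dvd_of_exp_eq_pow`).

For `n = 4`, an edge state is half the sum of eigenvectors for the eigenvalues `4` and `2`, which
`U(π / 2)` multiplies by `1` and `-1`; the result is the state of the opposite edge
(`transitionMatrix_mulVec_pairState_succ`).
-/

namespace PairStateTransfer

open Complex

/-! ### Eigenvectors and the transition matrix -/

section Spectral

variable {V : Type*} [Fintype V] [DecidableEq V]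

/-- An eigenvector `v` of `A` for `μ` is an eigenvector of `exp A` for `exp μ`: the matrix all of
whose columns are `v` intertwines `A` and `μ • 1`. -/
theorem exp_mulVec_of_mulVec_eq_smul {A : Matrix V V ℂ} {v : V → ℂ} {μ : ℂ}
    (h : A.mulVec v = μ • v) : (NormedSpace.exp A).mulVec v = exp μ • v := by
  have hs : SemiconjBy (Matrix.of fun i (_ : V) => v i) (Matrix.diagonal fun _ => μ) A := by
    ext i j
    have := congrFun h i
    simp only [Pi.smul_apply, smul_eq_mul] at this
    rw [Matrix.mul_diagonal, Matrix.of_apply, mul_comm, ← this]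
    rfl
  have he : SemiconjBy (Matrix.of fun i (_ : V) => v i)
      (NormedSpace.exp (Matrix.diagonal fun _ => μ)) (NormedSpace.exp A) := by
    open scoped Matrix.Norms.Operator in
    exact hs.exp_right
  rw [Matrix.exp_diagonal] at he
  ext i
  have hi := congrFun (congrFun he i) i
  rw [Matrix.mul_diagonal, Matrix.of_apply, Pi.coe_exp] at hi
  rw [Pi.smul_apply, smul_eq_mul, mul_comm, Complex.exp_eq_exp_ℂ, hi]
  rfl

theorem transitionMatrix_mulVec_of_eigenvector (G : SimpleGraph V) [DecidableRel G.Adj] (t : ℝ)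
    {v : V → ℂ} {θ : ℂ} (h : (G.lapMatrix ℂ).mulVec v = θ • v) :
    (transitionMatrix G t).mulVec v = exp (I * t * θ) • v := by
  apply exp_mulVec_of_mulVec_eq_smul
  rw [Matrix.smul_mulVec, h, smul_smul]

theorem transitionMatrix_transpose (G : SimpleGraph V) [DecidableRel G.Adj] (t : ℝ) :
    (transitionMatrix G t).transpose = transitionMatrix G t := by
  rw [transitionMatrix, ← Matrix.exp_transpose, Matrix.transpose_smul, (G.isSymm_lapMatrix ℂ).eq]

/-- Testing state transfer against a Laplacian eigenvector `v`. -/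
theorem exp_mul_sub_eq_of_transfer {G : SimpleGraph V} [DecidableRel G.Adj] {t : ℝ} {v : V → ℂ}
    {θ γ : ℂ} {a b c d : V} (hv : (G.lapMatrix ℂ).mulVec v = θ • v)
    (h : (transitionMatrix G t).mulVec (pairState a b) = γ • pairState c d) :
    exp (I * t * θ) * (v a - v b) = γ * (v c - v d) := by
  have := congrArg (v ⬝ᵥ ·) h
  simp only [Matrix.dotProduct_mulVec] at this
  rw [← Matrix.mulVec_transpose, transitionMatrix_transpose,
    transitionMatrix_mulVec_of_eigenvector G t hv] at this
  simpa [pairState, dotProduct_sub, mul_sub] using this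

end Spectral

/-! ### Characters as eigenvectors of the cycle -/

section Cycle

theorem lapMatrix_cycleGraph_mulVec_apply {n : ℕ} (v : Fin (n + 3) → ℂ) (j : Fin (n + 3)) :
    ((SimpleGraph.cycleGraph (n + 3)).lapMatrix ℂ).mulVec v j =
      2 * v j - (v (j - 1) + v (j + 1)) := by
  have hne : j - 1 ≠ j + 1 := by
    intro h
    have h2 : (1 : Fin (n + 3)) + 1 = 0 := by
      have := sub_eq_iff_eq_add.mp h
      rwa [add_assoc, left_eq_add] at this
    rw [Fin.ext_iff, Fin.val_add, Fin.val_one, Fin.val_zero, Nat.mod_eq_of_lt (by lia)] at h2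
    lia
  rw [SimpleGraph.lapMatrix_mulVec_apply, SimpleGraph.cycleGraph_degree_three_le,
    SimpleGraph.cycleGraph_neighborFinset, Finset.sum_pair hne]
  norm_num

theorem pow_val_add {n : ℕ} {ζ : ℂ} (hζ : ζ ^ n = 1) (i j : Fin n) :
    ζ ^ (i + j).val = ζ ^ i.val * ζ ^ j.val := by
  rw [Fin.val_add, ← pow_eq_pow_mod _ hζ, pow_add]

/-- The characters `j ↦ ζ ^ j`, for `ζ ^ n = 1`, are Laplacian eigenvectors of `C_n`, with
eigenvalue `2 - ζ - ζ⁻¹`. -/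
theorem lapMatrix_cycleGraph_mulVec_pow {n : ℕ} {ζ : ℂ} (hζ : ζ ^ (n + 3) = 1) :
    ((SimpleGraph.cycleGraph (n + 3)).lapMatrix ℂ).mulVec (fun j => ζ ^ j.val) =
      (2 - ζ - ζ⁻¹) • (fun j : Fin (n + 3) => ζ ^ j.val) := by
  have h0 : ζ ≠ 0 := by rintro rfl; simp at hζ
  ext j
  rw [lapMatrix_cycleGraph_mulVec_apply, Pi.smul_apply, smul_eq_mul, pow_val_add hζ]
  have h1 : ζ ^ (j - 1).val * ζ = ζ ^ j.val := by
    have := pow_val_add hζ (j - 1) 1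
    rwa [sub_add_cancel, Fin.val_one, pow_one, eq_comm] at this
  rw [← h1, Fin.val_one]
  field_simp
  ring

end Cycle

/-! ### Cycle lengths allowed by an antipodal translation -/

section Numbers

/-- For an odd divisor `p > 1` of `n = 2 * m`, the product of the hypothesis over the coset
`ζ * μ_p` reads `exp (2 * p * I * t) = ζ ^ (m * p)`, because the sums of the elements of the coset
and of their inverses vanish. The left side does not depend on `ζ`, the right side does. -/
theorem not_odd_dvd_of_exp_eq_pow {n m p : ℕ} (hnm : n = 2 * m) (hm : m ≠ 0) {t : ℝ}
    (h : ∀ ζ : ℂ, ζ ^ n = 1 → exp (I * t * (2 - ζ - ζ⁻¹)) = ζ ^ m)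
    (hp : Odd p) (hp1 : 1 < p) : ¬ p ∣ n := by
  intro hpn
  have hpm : p ∣ m := (Nat.Coprime.dvd_mul_left (Nat.coprime_two_right.mpr hp)).mp (hnm ▸ hpn)
  have hη := isPrimitiveRoot_exp p (by lia)
  have hω := isPrimitiveRoot_exp n (by lia)
  set η := exp (2 * Real.pi * I / p)
  set ω := exp (2 * Real.pi * I / n)
  have hηn : η ^ n = 1 := (hη.pow_eq_one_iff_dvd n).mpr hpn
  have hηm : η ^ m = 1 := (hη.pow_eq_one_iff_dvd m).mpr hpm
  have key : ∀ ζ : ℂ, ζ ^ n = 1 → exp (I * t * (2 * p)) = (ζ ^ m) ^ p := by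
    intro ζ hζ
    have h1 : ∀ j ∈ Finset.range p,
        exp (I * t * (2 - ζ * η ^ j - (ζ * η ^ j)⁻¹)) = ζ ^ m := by
      intro j _
      rw [h _ (by rw [mul_pow, hζ, ← pow_mul, mul_comm j, pow_mul, hηn, one_pow, one_mul]),
        mul_pow, ← pow_mul, mul_comm j, pow_mul, hηm, one_pow, mul_one]
    have h2 := Finset.prod_congr rfl h1
    rw [← exp_sum, Finset.prod_const, Finset.card_range, ← Finset.mul_sum] at h2
    rw [← h2]
    congr 2
    have hinv : ∑ j ∈ Finset.range p, (ζ * η ^ j)⁻¹ = 0 := by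
      simp_rw [mul_inv, ← inv_pow]
      rw [← Finset.mul_sum, hη.inv.geom_sum_eq_zero hp1, mul_zero]
    rw [Finset.sum_sub_distrib, Finset.sum_sub_distrib, hinv, ← Finset.mul_sum,
      hη.geom_sum_eq_zero hp1]
    simp [mul_comm]
  have hωm : ω ^ m = -1 := by
    refine IsPrimitiveRoot.eq_neg_one_of_two_right (hω.pow (by lia) ?_)
    rw [hnm, mul_comm]
  have e1 := key 1 (one_pow n)
  rw [key ω hω.pow_eq_one, hωm, hp.neg_one_pow] at e1
  norm_num at e1

/-- If `8 ∣ n`, then `ζ = I` and `ζ = exp (π * I / 4)`, whose eigenvalues are `2` and `2 - √2`,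
give `exp (2 * I * t) = 1` and `exp (2 * √2 * I * t) = 1`; irrationality of `√2` forces `t = 0`. -/
theorem not_eight_dvd_of_exp_eq_pow {n m : ℕ} (hnm : n = 2 * m) (hm : m ≠ 0) {t : ℝ}
    (h : ∀ ζ : ℂ, ζ ^ n = 1 → exp (I * t * (2 - ζ - ζ⁻¹)) = ζ ^ m) : ¬ 8 ∣ n := by
  rintro ⟨q, hq⟩
  have hmq : m = 4 * q := by lia
  have hI : exp (2 * t * I) = 1 := by
    have := h I (by rw [hq, show 8 * q = 4 * (2 * q) by ring, pow_mul, I_pow_four, one_pow])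
    rw [hmq, pow_mul, I_pow_four, one_pow, inv_I] at this
    rw [← this]
    congr 1
    ring
  have hs : ((√2 : ℝ) : ℂ) ^ 2 = 2 := by
    rw [← ofReal_pow, Real.sq_sqrt zero_le_two, ofReal_ofNat]
  have hs0 : ((√2 : ℝ) : ℂ) ≠ 0 := by
    intro h0
    rw [h0] at hs
    norm_num at hs
  set ρ : ℂ := (√2 : ℝ) / 2 * (1 + I)
  have hρ2 : ρ ^ 2 = I := by
    simp only [ρ]
    linear_combination (1 + I) ^ 2 / 4 * hs + I_sq / 2
  have hρinv : ρ⁻¹ = (√2 : ℝ) / 2 * (1 - I) := by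
    apply inv_eq_of_mul_eq_one_right
    simp only [ρ]
    linear_combination (1 - I ^ 2) / 4 * hs - I_sq / 2
  have hρ8 : ρ ^ 8 = 1 := by rw [show 8 = 2 * 4 by rfl, pow_mul, hρ2, I_pow_four]
  have hρ : exp (2 * √2 * t * I) = 1 := by
    have h1 := h ρ (by rw [hq, pow_mul, hρ8, one_pow])
    have h2 : exp (I * t * (2 - ρ - ρ⁻¹)) ^ 2 = 1 := by
      rw [h1, hmq, ← pow_mul, show 4 * q * 2 = 8 * q by ring, pow_mul, hρ8, one_pow]
    rw [← exp_nat_mul] at h2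
    have h3 : ((2 : ℕ) : ℂ) * (I * t * (2 - ρ - ρ⁻¹)) =
        2 * t * I + 2 * t * I - 2 * √2 * t * I := by
      rw [hρinv]
      simp only [ρ]
      push_cast
      ring
    rw [h3, exp_sub, exp_add, hI, one_mul, one_div, inv_eq_one] at h2
    exact h2
  have ht : t ≠ 0 := by
    rintro rfl
    have hω := isPrimitiveRoot_exp n (by lia)
    have h1 := h _ hω.pow_eq_one
    rw [ofReal_zero, mul_zero, zero_mul, exp_zero, eq_comm, hω.pow_eq_one_iff_dvd] at h1
    exact absurd (Nat.le_of_dvd (by lia) h1) (by lia)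
  obtain ⟨k, hk⟩ := exp_eq_one_iff.mp hI
  obtain ⟨l, hl⟩ := exp_eq_one_iff.mp hρ
  have hk' : t = k * Real.pi := by
    have : (t : ℂ) = k * Real.pi := by
      apply mul_right_cancel₀ (mul_ne_zero two_ne_zero I_ne_zero)
      linear_combination hk
    exact_mod_cast this
  have hl' : √2 * t = l * Real.pi := by
    have : ((√2 : ℝ) : ℂ) * t = l * Real.pi := by
      apply mul_right_cancel₀ (mul_ne_zero two_ne_zero I_ne_zero)
      linear_combination hl
    exact_mod_cast this
  have hk0 : (k : ℝ) ≠ 0 := by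
    intro h0
    rw [h0, zero_mul] at hk'
    exact ht hk'
  refine irrational_sqrt_two ⟨(l : ℚ) / k, ?_⟩
  push_cast
  rw [div_eq_iff hk0]
  apply mul_right_cancel₀ Real.pi_ne_zero
  rw [mul_assoc, ← hk', hl']

theorem eq_four_of_exp_eq_pow {n m : ℕ} (hnm : n = 2 * m) (hm : 2 ≤ m) {t : ℝ}
    (h : ∀ ζ : ℂ, ζ ^ n = 1 → exp (I * t * (2 - ζ - ζ⁻¹)) = ζ ^ m) : n = 4 := by
  obtain ⟨s, u, hu, hsu⟩ := Nat.exists_eq_two_pow_mul_odd (n := n) (by lia)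
  have hu1 : u = 1 := by
    by_contra hne
    have := hu.pos
    exact not_odd_dvd_of_exp_eq_pow hnm (by lia) h hu (by lia) (hsu ▸ dvd_mul_left _ _)
  rw [hu1, mul_one] at hsu
  have hs : s < 3 := by
    by_contra hs
    exact not_eight_dvd_of_exp_eq_pow hnm (by lia) h
      (hsu ▸ pow_dvd_pow 2 (show 3 ≤ s by lia))
  interval_cases s <;> lia

end Numbers

/-! ### Transfer from an edge is an antipodal translation -/

section Cycle

variable {n : ℕ} {t : ℝ} {γ : ℂ}

theorem pow_val_eq_iff {ω : ℂ} (hω : IsPrimitiveRoot ω n) {i j : Fin n} :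
    ω ^ i.val = ω ^ j.val ↔ i = j :=
  ⟨fun h => Fin.ext (hω.pow_inj i.isLt j.isLt h), fun h => h ▸ rfl⟩

/-- If transfer acts on the characters as a translation by `k = c - a ≠ 0`, then comparing
`ζ` with `ζ⁻¹`, which have the same eigenvalue, shows that `k` is the antipodal translation
`n / 2`. The eigenvalues of `ω` and `-ω` add up to `4`, the eigenvalue of `-1`, so the phase
is `1`. -/
theorem eq_four_of_translation (hn : 3 ≤ n) {a c : Fin n} (hac : a ≠ c)
    (h : ∀ ζ : ℂ, ζ ^ n = 1 → ζ ≠ 1 →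
      exp (I * t * (2 - ζ - ζ⁻¹)) * ζ ^ a.val = γ * ζ ^ c.val) : n = 4 := by
  have : NeZero n := ⟨by lia⟩
  obtain ⟨k, hk⟩ : ∃ k, k = (c - a).val := ⟨_, rfl⟩
  have hkn : k < n := hk ▸ (c - a).isLt
  have hk0 : k ≠ 0 := by
    rw [hk, Ne, Fin.val_eq_zero_iff, sub_eq_zero]
    exact hac.symm
  have hE : ∀ ζ : ℂ, ζ ^ n = 1 → ζ ≠ 1 → exp (I * t * (2 - ζ - ζ⁻¹)) = γ * ζ ^ k := by
    intro ζ hζ hζ1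
    have h0 : ζ ≠ 0 := by
      rintro rfl
      rw [zero_pow (by lia)] at hζ
      exact zero_ne_one hζ
    apply mul_right_cancel₀ (pow_ne_zero a.val h0)
    rw [h ζ hζ hζ1, mul_assoc, hk, ← pow_val_add hζ, sub_add_cancel]
  have hω := isPrimitiveRoot_exp n (by lia)
  set ω := exp (2 * Real.pi * I / n)
  have hω0 : ω ≠ 0 := exp_ne_zero _
  have hω1 : ω ≠ 1 := hω.ne_one (by lia)
  have e1 := hE ω hω.pow_eq_one hω1
  have hγ : γ ≠ 0 := by
    rintro rfl
    rw [zero_mul] at e1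
    exact exp_ne_zero _ e1
  have hnk : n = 2 * k := by
    have e2 := hE ω⁻¹ hω.inv.pow_eq_one (inv_ne_one.mpr hω1)
    rw [inv_inv, sub_right_comm, e1] at e2
    have e3 := mul_left_cancel₀ hγ e2
    have e4 : ω ^ (2 * k) = 1 := by
      rw [two_mul, pow_add]
      nth_rewrite 2 [e3]
      rw [inv_pow, mul_inv_cancel₀ (pow_ne_zero k hω0)]
    obtain ⟨r, hr⟩ := (hω.pow_eq_one_iff_dvd _).mp e4
    have : r < 2 := by
      by_contra hr2
      have : n * 2 ≤ n * r := Nat.mul_le_mul_left n (by lia)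
      lia
    interval_cases r <;> lia
  have hωk : ω ^ k = -1 :=
    IsPrimitiveRoot.eq_neg_one_of_two_right (hω.pow (by lia) (by rw [hnk, mul_comm]))
  have hnω : (-ω) ≠ 1 := by
    intro h'
    have : ω ^ 2 = 1 := by rw [← neg_sq, h', one_pow]
    have := Nat.le_of_dvd two_pos ((hω.pow_eq_one_iff_dvd 2).mp this)
    lia
  have heven : Even n := ⟨k, by lia⟩
  have hγ1 : γ = 1 := by
    have e2 := hE (-ω) (by rw [heven.neg_pow, hω.pow_eq_one]) hnω
    have e3 := hE (-1) (by rw [heven.neg_one_pow]) (by norm_num)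
    have e4 : exp (I * t * (2 - ω - ω⁻¹)) * exp (I * t * (2 - -ω - (-ω)⁻¹)) =
        exp (I * t * (2 - -1 - (-1)⁻¹)) := by
      rw [← exp_add]
      congr 1
      rw [inv_neg, inv_neg, inv_one]
      ring
    rw [e1, e2, e3, neg_pow ω, hωk] at e4
    have hs : ((-1 : ℂ) ^ k) ≠ 0 := pow_ne_zero _ (by norm_num)
    apply mul_left_cancel₀ (mul_ne_zero hγ hs)
    linear_combination e4
  refine eq_four_of_exp_eq_pow hnk (by lia) (t := t) fun ζ hζ => ?_
  by_cases hζ1 : ζ = 1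
  · rw [hζ1, inv_one, one_pow]
    norm_num
  · rw [hE ζ hζ hζ1, hγ1, one_mul]

theorem norm_exp_character {ζ : ℂ} (hζ : ‖ζ‖ = 1) : ‖exp (I * t * (2 - ζ - ζ⁻¹))‖ = 1 := by
  rw [norm_exp, inv_eq_conj hζ]
  simp

/-- Comparing norms at a primitive root of unity `ω` gives `‖1 - ω‖ = ‖ω ^ c - ω ^ d‖`, so a pair
that an edge is transferred to is again an edge. -/
theorem eq_add_one_of_character_transfer [NeZero n] (hn : 3 ≤ n) {a c d : Fin n} (hγ : ‖γ‖ = 1)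
    (h : ∀ ζ : ℂ, ζ ^ n = 1 → exp (I * t * (2 - ζ - ζ⁻¹)) * (ζ ^ a.val - ζ ^ (a + 1).val) =
      γ * (ζ ^ c.val - ζ ^ d.val)) : d = c + 1 ∨ c = d + 1 := by
  have hω := isPrimitiveRoot_exp n (by lia)
  set ω := exp (2 * Real.pi * I / n)
  have hω0 : ω ≠ 0 := exp_ne_zero _
  have hω1 : ‖ω‖ = 1 := hω.norm'_eq_one (by lia)
  have hone : (1 : Fin n).val = 1 := by rw [Fin.val_one', Nat.mod_eq_of_lt (by lia)]
  have hsucc (i : Fin n) : ω ^ (i + 1).val = ω ^ i.val * ω := by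
    rw [pow_val_add hω.pow_eq_one, hone, pow_one]
  have hnorm : ‖1 - ω‖ = ‖ω ^ c.val - ω ^ d.val‖ := by
    have e := congrArg norm (h ω hω.pow_eq_one)
    rw [hsucc, ← mul_one_sub, norm_mul, norm_mul, norm_mul, norm_exp_character hω1, norm_pow, hω1,
      hγ, one_pow, one_mul, one_mul, one_mul] at e
    exact e
  have hconj (k : ℕ) : (starRingEnd ℂ) (ω ^ k) = (ω ^ k)⁻¹ :=
    (inv_eq_conj (by rw [norm_pow, hω1, one_pow])).symm
  have hsq : (1 - ω) * (1 - ω⁻¹) =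
      (ω ^ c.val - ω ^ d.val) * ((ω ^ c.val)⁻¹ - (ω ^ d.val)⁻¹) := by
    have e : (1 - ω) * (starRingEnd ℂ) (1 - ω) =
        (ω ^ c.val - ω ^ d.val) * (starRingEnd ℂ) (ω ^ c.val - ω ^ d.val) := by
      rw [mul_conj', mul_conj', hnorm]
    rw [map_sub, map_sub, hconj, hconj, map_one, ← inv_eq_conj hω1] at e
    exact e
  rw [← pow_val_eq_iff hω, ← pow_val_eq_iff hω, hsucc, hsucc]
  have hC : ω ^ c.val ≠ 0 := pow_ne_zero _ hω0
  have hD : ω ^ d.val ≠ 0 := pow_ne_zero _ hω0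
  generalize ω ^ c.val = C at *
  generalize ω ^ d.val = D at *
  have hfac : (D - C * ω) * (C - D * ω) = 0 := by
    field_simp at hsq
    linear_combination -hsq
  rcases mul_eq_zero.mp hfac with h0 | h0
  · exact Or.inl (sub_eq_zero.mp h0)
  · exact Or.inr (sub_eq_zero.mp h0)

theorem eq_four_of_character_transfer_succ [NeZero n] (hn : 3 ≤ n) {a c d : Fin n} (hγ : ‖γ‖ = 1)
    (hne : s(a, a + 1) ≠ s(c, d))
    (h : ∀ ζ : ℂ, ζ ^ n = 1 → exp (I * t * (2 - ζ - ζ⁻¹)) * (ζ ^ a.val - ζ ^ (a + 1).val) =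
      γ * (ζ ^ c.val - ζ ^ d.val)) : n = 4 := by
  have hone : (1 : Fin n).val = 1 := by rw [Fin.val_one', Nat.mod_eq_of_lt (by lia)]
  rcases eq_add_one_of_character_transfer hn hγ h with rfl | rfl
  · refine eq_four_of_translation hn (a := a) (c := c) (t := t) (γ := γ) ?_ fun ζ hζ hζ1 => ?_
    · rintro rfl
      exact hne rfl
    · have e := h ζ hζ
      rw [pow_val_add hζ, pow_val_add hζ, hone, pow_one] at e
      apply mul_right_cancel₀ (sub_ne_zero.mpr hζ1)
      linear_combination -e
  · refine eq_four_of_translation hn (a := a) (c := d) (t := t) (γ := -γ) ?_ fun ζ hζ hζ1 => ?_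
    · rintro rfl
      exact hne Sym2.eq_swap
    · have e := h ζ hζ
      rw [pow_val_add hζ, pow_val_add hζ, hone, pow_one] at e
      apply mul_right_cancel₀ (sub_ne_zero.mpr hζ1)
      linear_combination -e

theorem eq_four_of_character_transfer (hn : 3 ≤ n) {a b c d : Fin n} (hγ : ‖γ‖ = 1)
    (hab : (SimpleGraph.cycleGraph n).Adj a b) (hne : s(a, b) ≠ s(c, d))
    (h : ∀ ζ : ℂ, ζ ^ n = 1 → exp (I * t * (2 - ζ - ζ⁻¹)) * (ζ ^ a.val - ζ ^ b.val) =
      γ * (ζ ^ c.val - ζ ^ d.val)) : n = 4 := by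
  obtain ⟨m, rfl⟩ := Nat.exists_eq_add_of_le' hn
  rw [SimpleGraph.cycleGraph_adj, sub_eq_iff_eq_add', sub_eq_iff_eq_add'] at hab
  rcases hab with rfl | rfl
  · refine eq_four_of_character_transfer_succ hn (a := b) (c := c) (d := d) (t := t) (γ := -γ)
      (by rwa [norm_neg]) (by rwa [Sym2.eq_swap]) fun ζ hζ => ?_
    linear_combination -h ζ hζ
  · exact eq_four_of_character_transfer_succ hn hγ hne h

theorem eq_four_of_hasPairPST (hn : 3 ≤ n) {a b c d : Fin n}
    (hadj : (SimpleGraph.cycleGraph n).Adj a b ∨ (SimpleGraph.cycleGraph n).Adj c d)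
    (h : HasPairPST (SimpleGraph.cycleGraph n) a b c d) : n = 4 := by
  obtain ⟨t, -, -, hne, -, γ, hγ, hU⟩ := h
  have key : ∀ ζ : ℂ, ζ ^ n = 1 → exp (I * t * (2 - ζ - ζ⁻¹)) * (ζ ^ a.val - ζ ^ b.val) =
      γ * (ζ ^ c.val - ζ ^ d.val) := by
    intro ζ hζ
    obtain ⟨m, rfl⟩ := Nat.exists_eq_add_of_le' hn
    exact exp_mul_sub_eq_of_transfer (v := fun j : Fin (m + 3) => ζ ^ j.val)
      (lapMatrix_cycleGraph_mulVec_pow hζ) hU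
  rcases hadj with hab | hcd
  · exact eq_four_of_character_transfer hn hγ hab hne key
  · -- Time reversal exchanges the two pairs.
    refine eq_four_of_character_transfer hn (t := -t) (γ := γ⁻¹) (by rw [norm_inv, hγ, inv_one])
      hcd hne.symm fun ζ hζ => ?_
    have hγ0 : γ ≠ 0 := norm_ne_zero_iff.mp (hγ ▸ one_ne_zero)
    rw [ofReal_neg, mul_neg, neg_mul, exp_neg, inv_mul_eq_iff_eq_mul₀ (exp_ne_zero _),
      mul_left_comm, key ζ hζ, inv_mul_cancel_left₀ hγ0]

end Cycle

/-! ### Transfer on the cycle of length four -/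

section FourCycle

theorem lapMatrix_mulVec_pairState_add (a : Fin 4) :
    ((SimpleGraph.cycleGraph 4).lapMatrix ℂ).mulVec
      (pairState a (a + 1) + pairState (a + 2) (a + 1 + 2)) =
      (4 : ℂ) • (pairState a (a + 1) + pairState (a + 2) (a + 1 + 2)) := by
  have hneg : (-1 : Fin 4) = 3 := rfl
  ext j
  rw [lapMatrix_cycleGraph_mulVec_apply (n := 1)]
  fin_cases a <;> fin_cases j <;> simp [pairState, hneg] <;> norm_num

theorem lapMatrix_mulVec_pairState_sub (a : Fin 4) :
    ((SimpleGraph.cycleGraph 4).lapMatrix ℂ).mulVec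
      (pairState a (a + 1) - pairState (a + 2) (a + 1 + 2)) =
      (2 : ℂ) • (pairState a (a + 1) - pairState (a + 2) (a + 1 + 2)) := by
  have hneg : (-1 : Fin 4) = 3 := rfl
  ext j
  rw [lapMatrix_cycleGraph_mulVec_apply (n := 1)]
  fin_cases a <;> fin_cases j <;> simp [pairState, hneg]

/-- An edge state of `C_4` is half the sum of eigenvectors for the eigenvalues `4` and `2`; at time
`π / 2` the first is fixed and the second is negated. -/
theorem transitionMatrix_mulVec_pairState_succ (a : Fin 4) :
    (transitionMatrix (SimpleGraph.cycleGraph 4) (Real.pi / 2)).mulVec (pairState a (a + 1)) =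
      pairState (a + 2) (a + 1 + 2) := by
  have h4 := transitionMatrix_mulVec_of_eigenvector _ (Real.pi / 2)
    (lapMatrix_mulVec_pairState_add a)
  have h2 := transitionMatrix_mulVec_of_eigenvector _ (Real.pi / 2)
    (lapMatrix_mulVec_pairState_sub a)
  have e4 : exp (I * (Real.pi / 2 : ℝ) * 4) = 1 := by
    rw [← exp_two_pi_mul_I]
    congr 1
    push_cast
    ring
  have e2 : exp (I * (Real.pi / 2 : ℝ) * 2) = -1 := by
    rw [← exp_pi_mul_I]
    congr 1
    push_cast
    ring
  rw [e4, one_smul, Matrix.mulVec_add] at h4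
  rw [e2, neg_one_smul, Matrix.mulVec_sub] at h2
  have hsum := congrArg₂ (· + ·) h4 h2
  ext j
  have := congrFun hsum j
  simp only [Pi.add_apply, Pi.sub_apply, Pi.neg_apply] at this
  linear_combination this / 2

theorem pairState_swap {V : Type*} [Fintype V] [DecidableEq V] (a b : V) :
    pairState a b = -pairState b a := (neg_sub _ _).symm

theorem transitionMatrix_mulVec_pairState_of_adj {a b : Fin 4}
    (hab : (SimpleGraph.cycleGraph 4).Adj a b) :
    (transitionMatrix (SimpleGraph.cycleGraph 4) (Real.pi / 2)).mulVec (pairState a b) =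
      pairState (a + 2) (b + 2) := by
  rw [SimpleGraph.cycleGraph_adj, sub_eq_iff_eq_add', sub_eq_iff_eq_add'] at hab
  rcases hab with rfl | rfl
  · rw [pairState_swap, Matrix.mulVec_neg, transitionMatrix_mulVec_pairState_succ, ← pairState_swap]
  · exact transitionMatrix_mulVec_pairState_succ a

theorem eq_add_two_of_opposite_edges : ∀ {a b c d : Fin 4},
    (SimpleGraph.cycleGraph 4).Adj a b → (SimpleGraph.cycleGraph 4).Adj c d →
    a ≠ c → a ≠ d → b ≠ c → b ≠ d → c = a + 2 ∧ d = b + 2 ∨ c = b + 2 ∧ d = a + 2 := by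
  decide

theorem hasPairPSTAt_of_opposite_edges {a b c d : Fin 4}
    (hab : (SimpleGraph.cycleGraph 4).Adj a b) (hcd : (SimpleGraph.cycleGraph 4).Adj c d)
    (hdisj : Disjoint ({a, b} : Set (Fin 4)) {c, d}) :
    HasPairPSTAt (SimpleGraph.cycleGraph 4) a b c d (Real.pi / 2) := by
  simp only [Set.disjoint_insert_left, Set.disjoint_singleton_left, Set.mem_insert_iff,
    Set.mem_singleton_iff, not_or] at hdisj
  obtain ⟨⟨hac, had⟩, hbc, hbd⟩ := hdisj
  refine ⟨hab.ne, hcd.ne, ?_, by positivity, ?_⟩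
  · rw [Ne, Sym2.eq_iff]
    exact fun h => h.elim (fun h => hac h.1) (fun h => had h.1)
  · have hU := transitionMatrix_mulVec_pairState_of_adj hab
    rcases eq_add_two_of_opposite_edges hab hcd hac had hbc hbd with ⟨rfl, rfl⟩ | ⟨rfl, rfl⟩
    · exact ⟨1, norm_one, by rw [hU, one_smul]⟩
    · exact ⟨-1, by rw [norm_neg, norm_one], by rw [hU, neg_one_smul, ← pairState_swap]⟩

end FourCycle

end PairStateTransfer

theorem mainTheorem2 :
    (∀ n : ℕ, 3 ≤ n →
      ((∃ a b c d : Fin n,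
          ((SimpleGraph.cycleGraph n).Adj a b ∨ (SimpleGraph.cycleGraph n).Adj c d) ∧
          PairStateTransfer.HasPairPST (SimpleGraph.cycleGraph n) a b c d) ↔
        n = 4)) ∧
    (∀ a b c d : Fin 4,
      (SimpleGraph.cycleGraph 4).Adj a b → (SimpleGraph.cycleGraph 4).Adj c d →
      Disjoint ({a, b} : Set (Fin 4)) {c, d} →
      PairStateTransfer.HasPairPSTAt (SimpleGraph.cycleGraph 4) a b c d (Real.pi / 2)) := by
  refine ⟨fun n hn => ⟨?_, ?_⟩, fun a b c d => PairStateTransfer.hasPairPSTAt_of_opposite_edges⟩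
  · rintro ⟨a, b, c, d, hadj, h⟩
    exact PairStateTransfer.eq_four_of_hasPairPST hn hadj h
  · rintro rfl
    have h01 : (SimpleGraph.cycleGraph 4).Adj 0 1 := by decide
    have h23 : (SimpleGraph.cycleGraph 4).Adj 2 3 := by decide
    exact ⟨0, 1, 2, 3, Or.inl h01, _,
      PairStateTransfer.hasPairPSTAt_of_opposite_edges h01 h23 (by simp)⟩
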